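/- Let $n_x,n_u\ge 0$ be integers. Let $f:\mathbb R^{n_x}\times\mathbb R^{n_u}\to\mathbb R^{n_x}$ be twice continuously differentiable and, for each fixed $u$, globally Lipschitz continuous in $x$, and let $l:\mathbb R^{n_x}\times\mathbb R^{n_u}\to\mathbb R$ be twice continuously differentiable. Put $H(x,u,\lambda)=\lambda^{\mathsf T}f(x,u)+l(x,u)$. Let $u^\star(x,\lambda)\in\operatorname{argmin}_u H(x,u,\lambda)$ be a minimizer that depends continuously on $(x,\lambda)\in\mathbb R^{2n_x}$ and at which the second order sufficient condition $H_{uu}(x,u^\star(x,\lambda),\lambda)\succ 0$ holds, for every $(x,\lambda)$. Let $$F(x,\lambda)=\begin{pmatrix} f(x,u^\star(x,\lambda))\\ -\nabla_xH(x,u^\star(x,\lambda),\lambda)\end{pmatrix}$$ be the right-hand side of Pontryagin's differential equation ($\nabla_x$ taken with $u$ and $\lambda$ fixed). Assume that its flow $\Gamma_t:\mathbb R^{2n_x}\to\mathbb R^{2n_x}$, given by $\frac{\mathrm d}{\mathrm dt}\Gamma_t(z)=F(\Gamma_t(z))$ and $\Gamma_0(z)=z$, is defined for all $t\in\mathbb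 R$ and all $z\in\mathbb R^{2n_x}$. Let $W=\mathbb W_{1,2}(\mathbb R^{2n_x})$ be the Sobolev space of complex-valued functions in $L_2$ whose weak gradient is in $L_2$. Let $U_t\Phi=\Phi\circ\Gamma_t$ be the Pontryagin–Koopman operator. For weakly differentiable $\varphi,\Phi$ (locally integrable with locally integrable weak gradient) for which the integral converges absolutely, let $$\omega(\varphi,\Phi)=\int_{\mathbb R^{2n_x}}\nabla\varphi(z)^{\mathsf T}\,\Omega\,\nabla\Phi(z)\,\mathrm dz,\qquad \Omega=\begin{pmatrix}0&I\\-I&0\end{pmatrix}.$$ Then for every $t\in\mathbb R$: 1. $U_t$ respects equality almost everywhere. For every $\varphi\in W$, the function $U_t\varphi$ is in $L_2$ and weakly differentiable. 2. If $\Gamma_t$ is globally Lipschitz, then for every function $\varphi:\mathbb R^{2n_x}\to\mathbb C$ one has $\varphi\in W$ if and only if $U_t\varphi\in W$; in particular $U_t$ maps $W$ into $W$. 3. $U_t$ is symplectic: for all $\varphi,\Phi\in W$ the integrals defining $\omega(\varphi,\Phi)$ and $\omega(U_t\varphi,U_t\Phi)$ converge absolutely, and $$\omega(U_t\varphi,U_t\Phi)=\omega(\varphi,\Phi).$$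 The same holds when ${}^{\mathsf T}$ is replaced by the Hermitian (conjugate) transpose in the definition of $\omega$. -/

import Mathlib

open MeasureTheory Matrix
open scoped ContDiff

noncomputable section

namespace PontryaginKoopman

/-! ### The optimal control problem and Pontryagin's differential equation -/

/-- The vector space `ℝⁿ` with its Euclidean norm. -/
abbrev Vec (n : ℕ) := EuclideanSpace ℝ (Fin n)

/-- The phase space `ℝ^{2n}`: the first `n` coordinates (`Sum.inl`) are the state `x`, the last `n`
coordinates (`Sum.inr`) are the co-state `λ`. -/
abbrev Phase (n : ℕ) := EuclideanSpace ℝ (Fin n ⊕ Fin n)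

/-- The state component `x` of `y = (x, λ)`. -/
def state {n : ℕ} (y : Phase n) : Vec n := WithLp.toLp 2 fun i => y (Sum.inl i)

/-- The co-state component `λ` of `y = (x, λ)`. -/
def costate {n : ℕ} (y : Phase n) : Vec n := WithLp.toLp 2 fun i => y (Sum.inr i)

/-- The stacked vector `(x, λ)`. -/
def stack {n : ℕ} (x p : Vec n) : Phase n := WithLp.toLp 2 (Sum.elim (fun i => x i) (fun i => p i))

/-- The dynamics `f(x, u)` is `C²` and, for each `u`, globally Lipschitz in `x`. The Lipschitz
constant may depend on `u`, so a Lipschitz constant uniform in `u` is a special case. -/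
structure DynamicsAssumption {n m : ℕ} (f : Vec n × Vec m → Vec n) : Prop where
  contDiff : ContDiff ℝ 2 f
  lipschitz : ∀ u, ∃ K, LipschitzWith K fun x => f (x, u)

/-- The stage cost `l(x, u)` is `C²`. -/
def CostAssumption {n m : ℕ} (l : Vec n × Vec m → ℝ) : Prop := ContDiff ℝ 2 l

/-- The Hamiltonian `H(x, u, λ) = λᵀ f(x, u) + l(x, u)`. -/
def hamiltonian {n m : ℕ} (f : Vec n × Vec m → Vec n) (l : Vec n × Vec m → ℝ)
    (x : Vec n) (u : Vec m) (p : Vec n) : ℝ :=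
  inner ℝ p (f (x, u)) + l (x, u)

/-- `ustar x λ` is a minimizer of `u ↦ H(x, u, λ)` that depends continuously on `(x, λ)` and
satisfies the second order sufficient condition: `H_uu` is positive definite there. -/
structure MinimizerAssumption {n m : ℕ} (f : Vec n × Vec m → Vec n) (l : Vec n × Vec m → ℝ)
    (ustar : Vec n → Vec n → Vec m) : Prop where
  continuous : Continuous fun q : Vec n × Vec n => ustar q.1 q.2
  minimizer : ∀ x p u, hamiltonian f l x (ustar x p) p ≤ hamiltonian f l x u p
  secondOrder : ∀ x p v, v ≠ 0 →
    0 < fderiv ℝ (fderiv ℝ fun u => hamiltonian f l x u p) (ustar x p) v v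

/-- The right-hand side of Pontryagin's differential equation,
`F(x, λ) = (f(x, u⋆(x, λ)), -∇ₓH(x, u⋆(x, λ), λ))`; in `∇ₓH` the control is held fixed. -/
def pontryaginField {n m : ℕ} (f : Vec n × Vec m → Vec n) (l : Vec n × Vec m → ℝ)
    (ustar : Vec n → Vec n → Vec m) (y : Phase n) : Phase n :=
  stack (f (state y, ustar (state y) (costate y)))
    (-gradient (fun x => hamiltonian f l x (ustar (state y) (costate y)) (costate y)) (state y))

/-- `Γ` is the (global) flow of `F`: `d/dt Γ_t(z) = F(Γ_t(z))` for all `t ∈ ℝ`, and `Γ_0(z) = z`. -/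
structure IsFlowOf {n : ℕ} (F : Phase n → Phase n) (Γ : ℝ → Phase n → Phase n) : Prop where
  hasDerivAt : ∀ t z, HasDerivAt (fun s => Γ s z) (F (Γ t z)) t
  zero : ∀ z, Γ 0 z = z

/-- The Pontryagin-Koopman operator `U_t Φ = Φ ∘ Γ_t`. -/
def koopman {n : ℕ} (Γ : ℝ → Phase n → Phase n) (t : ℝ) (Φ : Phase n → ℂ) : Phase n → ℂ :=
  Φ ∘ Γ t

/-! ### Weak gradients and the Sobolev space `W_{1,2}` -/

/-- `g` is a weak gradient of `φ`: both are locally integrable and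
`∫ φ ∂ᵢψ = -∫ gᵢ ψ` for every real test function `ψ ∈ C_c^∞` and every `i`. -/
structure HasWeakGradient {ι : Type*} [Fintype ι] [DecidableEq ι]
    (φ : EuclideanSpace ℝ ι → ℂ) (g : EuclideanSpace ℝ ι → ι → ℂ) : Prop where
  locallyIntegrable : LocallyIntegrable φ volume
  locallyIntegrable_gradient : ∀ i, LocallyIntegrable (fun z => g z i) volume
  integral_eq : ∀ ψ : EuclideanSpace ℝ ι → ℝ, ContDiff ℝ ∞ ψ → HasCompactSupport ψ → ∀ i,
    ∫ z, ((fderiv ℝ ψ z (EuclideanSpace.single i 1) : ℝ) : ℂ) * φ z =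
      -∫ z, ((ψ z : ℝ) : ℂ) * g z i

/-- `φ` is weakly differentiable. -/
def WeaklyDifferentiable {ι : Type*} [Fintype ι] [DecidableEq ι]
    (φ : EuclideanSpace ℝ ι → ℂ) : Prop := ∃ g, HasWeakGradient φ g

open Classical in
/-- The weak gradient `∇φ`, unique up to null sets, of a weakly differentiable function `φ`
(and `0` if `φ` is not weakly differentiable). -/
def weakGradient {ι : Type*} [Fintype ι] [DecidableEq ι]
    (φ : EuclideanSpace ℝ ι → ℂ) : EuclideanSpace ℝ ι → ι → ℂ :=
  if h : WeaklyDifferentiable φ then h.choose else 0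

/-- `φ` belongs to the Sobolev space `W_{1,2}`: it is square integrable, with a square integrable
weak gradient. -/
def MemW12 {ι : Type*} [Fintype ι] [DecidableEq ι] (φ : EuclideanSpace ℝ ι → ℂ) : Prop :=
  MemLp φ 2 volume ∧ ∃ g, HasWeakGradient φ g ∧ ∀ i, MemLp (fun z => g z i) 2 volume

/-! ### The symplectic form -/

/-- The block matrix `Ω = (0, I; -I, 0)`. -/
def Omega (n : ℕ) : Matrix (Fin n ⊕ Fin n) (Fin n ⊕ Fin n) ℂ :=
  Matrix.fromBlocks 0 1 (-1) 0

/-- The integrand `∇φᵀ Ω ∇Φ`, with the plain transpose. -/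
def omegaIntegrand {n : ℕ} (φ Φ : Phase n → ℂ) (z : Phase n) : ℂ :=
  weakGradient φ z ⬝ᵥ (Omega n *ᵥ weakGradient Φ z)

/-- The bilinear form `ω(φ, Φ) = ∫ ∇φᵀ Ω ∇Φ dz`. -/
def omega {n : ℕ} (φ Φ : Phase n → ℂ) : ℂ := ∫ z, omegaIntegrand φ Φ z

/-- The integrand `∇φᴴ Ω ∇Φ`, with the Hermitian transpose. -/
def omegaHermIntegrand {n : ℕ} (φ Φ : Phase n → ℂ) (z : Phase n) : ℂ :=
  star (weakGradient φ z) ⬝ᵥ (Omega n *ᵥ weakGradient Φ z)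

/-- The form `∫ ∇φᴴ Ω ∇Φ dz`, with the Hermitian transpose; it agrees with `omega` when `φ` is
real-valued. -/
def omegaHerm {n : ℕ} (φ Φ : Phase n → ℂ) : ℂ := ∫ z, omegaHermIntegrand φ Φ z

end PontryaginKoopman

end

open PontryaginKoopman

/-! Write h(x, λ) = H(x, u⋆(x, λ), λ) and let σ be the standard symplectic form. Since H_u = 0 and
H_uu is invertible at u⋆, the implicit function theorem makes u⋆, hence F, of class C¹. By the
envelope argument the variation of u⋆ drops out of dh, so dh = σ(F, ·)
(`hasFDerivAt_minimized_hamiltonian`). Symmetry of the second derivative of h then says that DF is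
infinitesimally symplectic.

Consequently the solution of the variational equation along an orbit, which is DΓ_t, preserves σ
(`exists_hasStrictFDerivAt_flow`). Symplectic matrices have determinant one, so Γ_t preserves volume
and U_t preserves L₂.

The weak chain rule ∇(φ ∘ Γ_t) = DΓ_tᵀ (∇φ ∘ Γ_t) needs an argument, because Γ_t is only C¹ and does
not carry smooth test functions to smooth ones; mollifying vector fields closes the gap
(`HasWeakGradient.integral_divergence_mul`). With DΓ_t Ω DΓ_tᵀ = Ω the integrand of ω is merely
composed with Γ_t, and a volume preserving substitution gives the invariance without any bound on
DΓ_t. Such a bound, supplied by a Lipschitz constant, is needed only to keep gradients in L₂; the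
inverse flow inherits it because σ(D⁻¹a, b) = σ(a, Db). -/

section FlowDerivative

/-! ### Differentiability of the flow in the initial point -/

open Set Metric Filter Topology

variable {E : Type*} [NormedAddCommGroup E] [NormedSpace ℝ E]

/-- A linear differential equation with continuous coefficients is solvable on all of `[0, T]`. -/
theorem exists_solution_linear_ode [FiniteDimensional ℝ E] {A : ℝ → E →L[ℝ] E} (hA : Continuous A) {T : ℝ} (hT : 0 ≤ T)
    (y₀ : E) : ∃ Y : ℝ → E, Y 0 = y₀ ∧
      ∀ t ∈ Icc 0 T, HasDerivWithinAt Y (A t (Y t)) (Icc 0 T) t := by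
  have : CompleteSpace E := FiniteDimensional.complete ℝ E
  obtain ⟨M, hM⟩ := (isCompact_Icc (a := (0 : ℝ)) (b := T)).exists_bound_of_continuousOn
    hA.continuousOn
  have hM0 : 0 ≤ M := (norm_nonneg _).trans (hM 0 ⟨le_rfl, hT⟩)
  -- R exceeds the a priori Grönwall bound. Cutting the equation off outside radius R bounds the
  -- right-hand side globally, so Picard–Lindelöf covers all of `[0, T]` at once; the solution never
  -- reaches the cut-off region.
  set R : ℝ := ‖y₀‖ * Real.exp (M * T) + 1 with hR
  have hRpos : 0 < R := by positivity
  let χ : ContDiffBump (0 : E) := ⟨R, 2 * R, hRpos, by linarith⟩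
  let ρ : E → E := fun y => χ y • y
  have hρ1 : ContDiff ℝ 1 ρ := χ.contDiff.smul contDiff_id
  have hρc : HasCompactSupport ρ := χ.hasCompactSupport.smul_right
  obtain ⟨K, hK⟩ := hρ1.lipschitzWith_of_hasCompactSupport hρc one_ne_zero
  have hρle : ∀ y, ‖ρ y‖ ≤ ‖y‖ := fun y => by
    rw [norm_smul, Real.norm_of_nonneg χ.nonneg]
    exact mul_le_of_le_one_left (norm_nonneg _) χ.le_one
  have hρR : ∀ y, ‖ρ y‖ ≤ 2 * R := fun y => by
    by_cases hy : y ∈ ball (0 : E) (2 * R)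
    · exact (hρle y).trans (mem_ball_zero_iff.1 hy).le
    · have : χ y = 0 := χ.zero_of_le_dist (not_lt.1 hy)
      simp [ρ, this, hRpos.le]
  have hρid : ∀ y, ‖y‖ ≤ R → ρ y = y := fun y hy => by
    have : χ y = 1 := χ.one_of_mem_closedBall (by simpa using hy)
    simp [ρ, this]
  let M' : NNReal := ⟨M, hM0⟩
  let T' : NNReal := ⟨T, hT⟩
  let R' : NNReal := ⟨R, hRpos.le⟩
  have hPL : IsPicardLindelof (fun t y => A t (ρ y)) (⟨0, le_rfl, hT⟩ : Icc (0 : ℝ) T) y₀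
      (M' * (2 * R') * T') 0 (M' * (2 * R')) (M' * K) := by
    refine ⟨fun t ht => ?_, fun x _ => ?_, fun t ht x _ => ?_, ?_⟩
    · exact (((A t).lipschitz.weaken (show ‖A t‖₊ ≤ M' from hM t ht)).comp hK).lipschitzOnWith
    · fun_prop
    · exact ((A t).le_opNorm _).trans
        (mul_le_mul (hM t ht) (hρR x) (norm_nonneg _) hM0)
    · have : max (T - 0) (0 - 0) = T := by simp [hT]
      rw [this, NNReal.coe_zero, sub_zero]
      exact (NNReal.coe_mul (M' * (2 * R')) T').ge
  obtain ⟨Y, hY0, hY⟩ := hPL.exists_eq_forall_mem_Icc_hasDerivWithinAt₀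
  refine ⟨Y, hY0, fun t ht => ?_⟩
  have hYR : ∀ s ∈ Icc 0 T, ‖Y s‖ ≤ R := fun s hs => by
    have := norm_le_gronwallBound_of_norm_deriv_right_le (f := Y)
      (f' := fun s => A s (ρ (Y s))) (δ := ‖y₀‖) (K := M) (ε := 0) (a := 0) (b := T)
      (fun s hs => (hY s hs).continuousWithinAt)
      (fun s hs => (hY s ⟨hs.1, hs.2.le⟩).mono_of_mem_nhdsWithin
        (Icc_mem_nhdsGE_of_mem hs)) (by rw [← hY0])
      (fun s hs => by
        rw [add_zero]
        exact ((A s).le_opNorm _).trans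
          (mul_le_mul (hM s ⟨hs.1, hs.2.le⟩) (hρle _) (norm_nonneg _) hM0)) s hs
    rw [gronwallBound_ε0, sub_zero] at this
    have h2 : Real.exp (M * s) ≤ Real.exp (M * T) :=
      Real.exp_le_exp.2 (mul_le_mul_of_nonneg_left hs.2 hM0)
    nlinarith [norm_nonneg y₀]
  have := hY t ht
  rwa [hρid _ (hYR t ht)] at this

variable {F : E → E}

theorem ContDiff.exists_lipschitzOnWith_of_isCompact (hF : ContDiff ℝ 1 F) {s : Set E}
    (hs : IsCompact s) : ∃ K, LipschitzOnWith K F s :=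
  hF.locallyLipschitz.locallyLipschitzOn.exists_lipschitzOnWith_of_compact hs

/-- Two orbit segments fill a compact set, on which a C¹ field has one Lipschitz constant; Grönwall
with zero initial distance then applies. -/
theorem eq_of_hasDerivAt_of_nonneg (hF : ContDiff ℝ 1 F) {c d : ℝ → E}
    (hc : ∀ s, HasDerivAt c (F (c s)) s) (hd : ∀ s, HasDerivAt d (F (d s)) s) (h0 : c 0 = d 0)
    {t : ℝ} (ht : 0 ≤ t) : c t = d t := by
  have hcc : Continuous c := continuous_iff_continuousAt.2 fun s => (hc s).continuousAt
  have hdc : Continuous d := continuous_iff_continuousAt.2 fun s => (hd s).continuousAt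
  have hK : IsCompact (c '' Icc 0 t ∪ d '' Icc 0 t) :=
    (isCompact_Icc.image hcc).union (isCompact_Icc.image hdc)
  obtain ⟨K, hK⟩ := hF.exists_lipschitzOnWith_of_isCompact hK
  have := dist_le_of_trajectories_ODE_of_mem (v := fun _ => F) (K := K) (a := 0) (b := t) (δ := 0)
    (s := fun _ => c '' Icc 0 t ∪ d '' Icc 0 t) (fun _ _ => hK)
    hcc.continuousOn (fun s _ => (hc s).hasDerivWithinAt)
    (fun s hs => Or.inl ⟨s, ⟨hs.1, hs.2.le⟩, rfl⟩)
    hdc.continuousOn (fun s _ => (hd s).hasDerivWithinAt)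
    (fun s hs => Or.inr ⟨s, ⟨hs.1, hs.2.le⟩, rfl⟩) (by rw [h0, dist_self]) t ⟨ht, le_rfl⟩
  rw [zero_mul] at this
  exact dist_le_zero.1 this

theorem hasDerivAt_comp_neg {c : ℝ → E} (hc : ∀ s, HasDerivAt c (F (c s)) s) (s : ℝ) :
    HasDerivAt (fun s => c (-s)) ((-F) (c (-s))) s := by
  simpa [Function.comp_def] using (hc (-s)).scomp s (hasDerivAt_neg s)

theorem eq_of_hasDerivAt (hF : ContDiff ℝ 1 F) {c d : ℝ → E}
    (hc : ∀ s, HasDerivAt c (F (c s)) s) (hd : ∀ s, HasDerivAt d (F (d s)) s) (h0 : c 0 = d 0)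
    (t : ℝ) : c t = d t := by
  rcases le_total 0 t with ht | ht
  · exact eq_of_hasDerivAt_of_nonneg hF hc hd h0 ht
  · have := eq_of_hasDerivAt_of_nonneg hF.neg (hasDerivAt_comp_neg hc) (hasDerivAt_comp_neg hd)
      (by simpa using h0) (neg_nonneg.2 ht)
    simpa using this

variable {Γ : ℝ → E → E}

/-- By uniqueness, s ↦ Γ_s(Γ_t z) and s ↦ Γ_{s+t} z coincide; evaluate at s = -t. This provides the
inverse of Γ_t. -/
theorem flow_neg_flow (hF : ContDiff ℝ 1 F)
    (hΓ : ∀ t z, HasDerivAt (fun s => Γ s z) (F (Γ t z)) t) (h0 : ∀ z, Γ 0 z = z) (t : ℝ) (z : E) :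
    Γ (-t) (Γ t z) = z := by
  have := eq_of_hasDerivAt hF (c := fun s => Γ s (Γ t z)) (d := fun s => Γ (s + t) z)
    (fun s => hΓ s _) (fun s => (hΓ (s + t) z).comp_add_const s t) (by simp [h0]) (-t)
  simpa [h0] using this

/-- As long as it stays in a tube around the orbit of `z₀`, the orbit of a nearby point is
controlled by Grönwall's inequality, hence it never leaves the tube. -/
theorem exists_flow_lipschitzOnWith [FiniteDimensional ℝ E] (hF : ContDiff ℝ 1 F)
    (hΓ : ∀ t z, HasDerivAt (fun s => Γ s z) (F (Γ t z)) t) (h0 : ∀ z, Γ 0 z = z)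
    {T : ℝ} (z₀ : E) {δ : ℝ} (hδ : 0 < δ) :
    ∃ r > 0, ∃ L : ℝ, 0 ≤ L ∧ ∀ s ∈ Icc 0 T, ∀ w ∈ ball z₀ r, ∀ w' ∈ ball z₀ r,
      dist (Γ s w) (Γ s z₀) < δ ∧ dist (Γ s w) (Γ s w') ≤ L * dist w w' := by
  have hcont : ∀ z, Continuous fun s => Γ s z := fun z =>
    continuous_iff_continuousAt.2 fun s => (hΓ s z).continuousAt
  set O := (fun s => Γ s z₀) '' Icc 0 T
  have hO : IsCompact (cthickening δ O) := (isCompact_Icc.image (hcont z₀)).cthickening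
  obtain ⟨K, hK⟩ := hF.exists_lipschitzOnWith_of_isCompact hO
  have mem_tube : ∀ s ∈ Icc 0 T, ∀ y, dist y (Γ s z₀) < δ → y ∈ cthickening δ O := fun s hs y hy =>
    mem_cthickening_of_dist_le y _ δ O ⟨s, hs, rfl⟩ hy.le
  -- The tube condition is asked only before time b, so that the estimate can be used at a first
  -- exit time.
  have key : ∀ b ∈ Icc 0 T, ∀ w w', (∀ s ∈ Ico 0 b, dist (Γ s w) (Γ s z₀) < δ) →
      (∀ s ∈ Ico 0 b, dist (Γ s w') (Γ s z₀) < δ) →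
      dist (Γ b w) (Γ b w') ≤ Real.exp (K * T) * dist w w' := by
    intro b hb w w' hw hw'
    have hsub : ∀ s ∈ Ico 0 b, s ∈ Icc 0 T := fun s hs => ⟨hs.1, hs.2.le.trans hb.2⟩
    have := dist_le_of_trajectories_ODE_of_mem (v := fun _ => F) (K := K) (a := 0) (b := b)
      (δ := dist w w') (s := fun _ => cthickening δ O) (fun _ _ => hK)
      (hcont w).continuousOn (fun s _ => (hΓ s w).hasDerivWithinAt)
      (fun s hs => mem_tube s (hsub s hs) _ (hw s hs))
      (hcont w').continuousOn (fun s _ => (hΓ s w').hasDerivWithinAt)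
      (fun s hs => mem_tube s (hsub s hs) _ (hw' s hs)) (by simp [h0]) b ⟨hb.1, le_rfl⟩
    rw [sub_zero, mul_comm] at this
    refine this.trans (mul_le_mul_of_nonneg_right (Real.exp_le_exp.2 ?_) dist_nonneg)
    exact mul_le_mul_of_nonneg_left hb.2 K.2
  have hexp : 0 < Real.exp (K * T) := Real.exp_pos _
  have stay : ∀ w ∈ ball z₀ (δ / (2 * Real.exp (K * T))), ∀ s ∈ Icc 0 T,
      dist (Γ s w) (Γ s z₀) < δ := by
    intro w hw
    by_contra! hcon
    have hclosed : IsCompact (Icc 0 T ∩ {s | δ ≤ dist (Γ s w) (Γ s z₀)}) :=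
      isCompact_Icc.inter_right (isClosed_le continuous_const ((hcont w).dist (hcont z₀)))
    -- At the first time b when the distance reaches δ, Grönwall still bounds it by δ / 2, a
    -- contradiction.
    obtain ⟨b, ⟨hb, hbδ⟩, hmin⟩ := hclosed.exists_isLeast hcon
    have hlt : ∀ s ∈ Ico 0 b, dist (Γ s w) (Γ s z₀) < δ := fun s hs => by
      by_contra! h
      exact absurd (hmin ⟨⟨hs.1, hs.2.le.trans hb.2⟩, h⟩) (not_le.2 hs.2)
    have h1 := key b hb w z₀ hlt (fun s _ => by simpa using hδ)
    have h2 : Real.exp (K * T) * dist w z₀ ≤ δ / 2 := by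
      have := (lt_div_iff₀ (by positivity)).1 (mem_ball.1 hw)
      linarith
    simp only [mem_ofPred_eq] at hbδ
    linarith
  refine ⟨_, by positivity, _, hexp.le, fun s hs w hw w' hw' => ⟨stay w hw s hs, ?_⟩⟩
  exact key s hs w w' (fun u hu => stay w hw u ⟨hu.1, hu.2.le.trans hs.2⟩)
    (fun u hu => stay w' hw' u ⟨hu.1, hu.2.le.trans hs.2⟩)

/-- The flow is strictly differentiable in the initial point, and its derivative preserves every
bilinear form that is infinitesimally invariant under the vector field. -/
theorem exists_hasStrictFDerivAt_flow_of_nonneg [FiniteDimensional ℝ E] (hF : ContDiff ℝ 1 F)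
    (hΓ : ∀ t z, HasDerivAt (fun s => Γ s z) (F (Γ t z)) t) (h0 : ∀ z, Γ 0 z = z)
    (B : E →L[ℝ] E →L[ℝ] ℝ) (hB : ∀ y a b, B (fderiv ℝ F y a) b + B a (fderiv ℝ F y b) = 0)
    {T : ℝ} (hT : 0 ≤ T) (z₀ : E) :
    ∃ D : E →L[ℝ] E, HasStrictFDerivAt (Γ T) D z₀ ∧ ∀ a b, B (D a) (D b) = B a b := by
  have hcont : ∀ z, Continuous fun s => Γ s z := fun z =>
    continuous_iff_continuousAt.2 fun s => (hΓ s z).continuousAt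
  have hDF : Continuous (fderiv ℝ F) := hF.continuous_fderiv one_ne_zero
  set A : ℝ → E →L[ℝ] E := fun s => fderiv ℝ F (Γ s z₀)
  have hA : Continuous A := hDF.comp (hcont z₀)
  -- The variational equation Y' = DF(Γ_s z₀) Y with Y(0) = id; Y(T) will be the derivative of Γ_T.
  obtain ⟨Y, hY0, hY⟩ := exists_solution_linear_ode
    (A := fun s => ContinuousLinearMap.compL ℝ E E E (A s)) (by fun_prop) hT
    (ContinuousLinearMap.id ℝ E)
  have hYa : ∀ a, ∀ s ∈ Icc 0 T, HasDerivWithinAt (fun s => Y s a) (A s (Y s a)) (Icc 0 T) s :=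
    fun a s hs => by
      simpa using (hY s hs).clm_apply (hasDerivWithinAt_const s (Icc 0 T) a)
  refine ⟨Y T, ?_, fun a b => ?_⟩
  swap
  -- By the product rule and `hB`, s ↦ B(Y a, Y b) has zero derivative, so it keeps its initial
  -- value B(a, b).
  · have hd : ∀ s ∈ Icc 0 T, HasDerivWithinAt (fun s => B (Y s a) (Y s b)) 0 (Icc 0 T) s := by
      intro s hs
      have h1 := (B.hasFDerivAt.comp_hasDerivWithinAt s (hYa a s hs)).clm_apply (hYa b s hs)
      exact h1.congr_deriv (hB _ _ _)
    have := constant_of_has_deriv_right_zero (fun s hs => (hd s hs).continuousWithinAt)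
      (fun s hs => (hd s ⟨hs.1, hs.2.le⟩).mono_of_mem_nhdsWithin (Icc_mem_nhdsGE_of_mem hs)) T
      ⟨hT, le_rfl⟩
    simpa [hY0] using this
  obtain ⟨M, hM⟩ := (isCompact_Icc (a := (0 : ℝ)) (b := T)).exists_bound_of_continuousOn
    hA.continuousOn
  have hM0 : 0 ≤ M := (norm_nonneg _).trans (hM 0 ⟨le_rfl, hT⟩)
  obtain ⟨r₁, hr₁, L, hL, hLip⟩ := exists_flow_lipschitzOnWith (T := T) hF hΓ h0 z₀ one_pos
  rw [hasStrictFDerivAt_iff_isLittleO, Asymptotics.isLittleO_iff]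
  intro c hc
  set G := gronwallBound 0 M 1 T
  have hG : 0 ≤ G := by
    have := gronwallBound_mono (le_refl (0 : ℝ)) zero_le_one hM0 hT
    rwa [gronwallBound_x0] at this
  set O := (fun s => Γ s z₀) '' Icc 0 T
  have hO : IsCompact (cthickening 1 O) := (isCompact_Icc.image (hcont z₀)).cthickening
  -- Chosen so that ε L G ≤ c, the final error constant; the added ones avoid division by zero.
  set ε : ℝ := c / ((G + 1) * (L + 1)) with hε
  have hεpos : 0 < ε := by positivity
  obtain ⟨δ, hδ, huc⟩ := Metric.uniformContinuousOn_iff.1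
    (hO.uniformContinuousOn_of_continuous hDF.continuousOn) ε hεpos
  obtain ⟨r₂, hr₂, _, _, hnear⟩ :=
    exists_flow_lipschitzOnWith (T := T) hF hΓ h0 z₀ (lt_min hδ one_pos)
  have hev : ∀ᶠ p : E × E in 𝓝 (z₀, z₀), (p.1 ∈ ball z₀ r₁ ∧ p.1 ∈ ball z₀ r₂) ∧
      p.2 ∈ ball z₀ r₁ ∧ p.2 ∈ ball z₀ r₂ := by
    rw [nhds_prod_eq]
    have h := inter_mem (ball_mem_nhds z₀ hr₁) (ball_mem_nhds z₀ hr₂)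
    exact prod_mem_prod h h
  filter_upwards [hev] with p hp
  obtain ⟨⟨h11, h12⟩, h21, h22⟩ := hp
  -- Mean value inequality on a ball about Γ_s z₀ where DF is within ε of A s. Two arbitrary nearby
  -- orbits are compared, neither being that of z₀, which is what strict differentiability requires.
  have hrem : ∀ s ∈ Icc 0 T, ‖F (Γ s p.1) - F (Γ s p.2) - A s (Γ s p.1 - Γ s p.2)‖ ≤
      ε * (L * ‖p.1 - p.2‖) := by
    intro s hs
    have h1 := (hnear s hs p.1 h12 p.1 h12).1
    have h2 := (hnear s hs p.2 h22 p.1 h12).1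
    have hz : Γ s z₀ ∈ cthickening 1 O := self_subset_cthickening O ⟨s, hs, rfl⟩
    have := (convex_ball (Γ s z₀) (min δ 1)).norm_image_sub_le_of_norm_hasFDerivWithin_le'
      (f := F) (f' := fderiv ℝ F) (φ := A s) (C := ε)
      (fun y _ => ((hF.differentiable one_ne_zero) y).hasFDerivAt.hasFDerivWithinAt)
      (fun y hy => by
        rw [← dist_eq_norm]
        have hy' := lt_min_iff.1 (mem_ball.1 hy)
        exact (huc y (mem_cthickening_of_dist_le y _ 1 O ⟨s, hs, rfl⟩ hy'.2.le) _ hz hy'.1).le)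
      (mem_ball.2 h2) (mem_ball.2 h1)
    refine this.trans (mul_le_mul_of_nonneg_left ?_ hεpos.le)
    simpa [dist_eq_norm] using (hLip s hs p.1 h11 p.2 h21).2
  -- The linearization error w starts at zero and satisfies ‖w'‖ ≤ M‖w‖ + ε L ‖p.1 - p.2‖.
  have hgr := norm_le_gronwallBound_of_norm_deriv_right_le
    (f := fun s => Γ s p.1 - Γ s p.2 - Y s (p.1 - p.2))
    (f' := fun s => F (Γ s p.1) - F (Γ s p.2) - A s (Y s (p.1 - p.2)))
    (δ := 0) (K := M) (ε := ε * (L * ‖p.1 - p.2‖)) (a := 0) (b := T)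
    (fun s hs => (((hΓ s p.1).hasDerivWithinAt.sub (hΓ s p.2).hasDerivWithinAt).sub
      (hYa (p.1 - p.2) s hs)).continuousWithinAt)
    (fun s hs => ((hΓ s p.1).hasDerivWithinAt.sub (hΓ s p.2).hasDerivWithinAt).sub
      ((hYa (p.1 - p.2) s ⟨hs.1, hs.2.le⟩).mono_of_mem_nhdsWithin (Icc_mem_nhdsGE_of_mem hs)))
    (by simp [h0, hY0])
    (fun s hs => by
      have hs' : s ∈ Icc 0 T := ⟨hs.1, hs.2.le⟩
      have heq : F (Γ s p.1) - F (Γ s p.2) - A s (Y s (p.1 - p.2)) =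
          A s (Γ s p.1 - Γ s p.2 - Y s (p.1 - p.2)) +
          (F (Γ s p.1) - F (Γ s p.2) - A s (Γ s p.1 - Γ s p.2)) := by
        rw [map_sub (A s) (Γ s p.1 - Γ s p.2)]; abel
      rw [heq]
      refine (norm_add_le _ _).trans (add_le_add ?_ (hrem s hs'))
      exact ((A s).le_opNorm _).trans (mul_le_mul_of_nonneg_right (hM s hs') (norm_nonneg _)))
    T ⟨hT, le_rfl⟩
  have hlin : gronwallBound 0 M (ε * (L * ‖p.1 - p.2‖)) (T - 0) =
      ε * (L * ‖p.1 - p.2‖) * G := by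
    simp only [G, gronwallBound, sub_zero]
    split_ifs <;> ring
  rw [hlin] at hgr
  refine hgr.trans ?_
  have h3 : ε * L * G ≤ c := by
    have : ε * ((G + 1) * (L + 1)) = c := div_mul_cancel₀ _ (by positivity)
    nlinarith [mul_nonneg hεpos.le hG, mul_nonneg hεpos.le hL]
  calc ε * (L * ‖p.1 - p.2‖) * G = ε * L * G * ‖p.1 - p.2‖ := by ring
    _ ≤ c * ‖p.1 - p.2‖ := mul_le_mul_of_nonneg_right h3 (norm_nonneg _)

theorem exists_hasStrictFDerivAt_flow [FiniteDimensional ℝ E] (hF : ContDiff ℝ 1 F)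
    (hΓ : ∀ t z, HasDerivAt (fun s => Γ s z) (F (Γ t z)) t) (h0 : ∀ z, Γ 0 z = z)
    (B : E →L[ℝ] E →L[ℝ] ℝ) (hB : ∀ y a b, B (fderiv ℝ F y a) b + B a (fderiv ℝ F y b) = 0)
    (t : ℝ) (z₀ : E) :
    ∃ D : E →L[ℝ] E, HasStrictFDerivAt (Γ t) D z₀ ∧ ∀ a b, B (D a) (D b) = B a b := by
  rcases le_total 0 t with ht | ht
  · exact exists_hasStrictFDerivAt_flow_of_nonneg hF hΓ h0 B hB ht z₀
  · have := exists_hasStrictFDerivAt_flow_of_nonneg (Γ := fun s => Γ (-s)) hF.neg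
      (fun s z => hasDerivAt_comp_neg (fun s => hΓ s z) s) (by simpa using h0) B
      (fun y a b => by
        have := hB y a b
        change B (fderiv ℝ (-F) y a) b + B a (fderiv ℝ (-F) y b) = 0
        rw [fderiv_neg]
        simp only [_root_.neg_apply, map_neg]
        linarith) (neg_nonneg.2 ht) z₀
    simpa using this

/-- A map that is strictly differentiable everywhere is continuously differentiable. -/
theorem contDiff_one_of_hasStrictFDerivAt {f : E → E} {f' : E → E →L[ℝ] E}
    (hf : ∀ x, HasStrictFDerivAt f (f' x) x) : ContDiff ℝ 1 f := by
  have hfd : fderiv ℝ f = f' := funext fun x => (hf x).hasFDerivAt.fderiv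
  refine contDiff_one_iff_fderiv.2 ⟨fun x => (hf x).hasFDerivAt.differentiableAt, ?_⟩
  rw [hfd, Metric.continuous_iff']
  intro x ε hε
  obtain ⟨s, hs, hlip⟩ := (hf x).approximates_deriv_on_nhds (c := ⟨ε / 2, by positivity⟩)
    (Or.inr (NNReal.coe_pos.1 (half_pos hε)))
  filter_upwards [eventually_eventually_nhds.2 hs] with y hy
  rw [dist_eq_norm]
  -- Strict differentiability at x makes f - f'(x) Lipschitz with constant ε / 2 near x, which
  -- bounds its derivative f'(y) - f'(x) at nearby y.
  have h2 : HasFDerivAt (fun z => f z - f' x z) (f' y - f' x) y :=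
    (hf y).hasFDerivAt.sub (f' x).hasFDerivAt
  have := h2.le_of_lipschitzOn hy (ApproximatesLinearOn.lipschitzOnWith hlip)
  refine this.trans_lt ?_
  change ε / 2 < ε
  linarith

end FlowDerivative

/-! ### Chain rule for weak gradients -/

section WeakChainRule

open Set Metric Filter Topology ContinuousLinearMap
open scoped Convolution

variable {ι : Type*} [Fintype ι]

/-- The derivative falls on the smooth factor, so c needs no regularity. -/
theorem fderiv_convolution_apply {η c : EuclideanSpace ℝ ι → ℝ} (hη : ContDiff ℝ ∞ η)
    (hηc : HasCompactSupport η) (hc : LocallyIntegrable c volume) (y v : EuclideanSpace ℝ ι) :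
    fderiv ℝ (η ⋆[lsmul ℝ ℝ, volume] c) y v = ∫ t, fderiv ℝ η (y - t) v * c t := by
  rw [← convolution_flip]
  rw [(hηc.hasFDerivAt_convolution_right (lsmul ℝ ℝ).flip hc (hη.of_le (by simp)) y).fderiv,
    convolution_precompR_apply _ hc (hηc.fderiv ℝ) (hη.continuous_fderiv (by simp))]
  rfl

/-- The mollifications of a continuous function of compact support converge to it when tested
against a locally integrable function. -/
theorem tendsto_integral_convolution_mul {c : EuclideanSpace ℝ ι → ℝ} (hc : Continuous c)
    (hcc : HasCompactSupport c) {φ : EuclideanSpace ℝ ι → ℂ} (hφ : LocallyIntegrable φ volume)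
    {η : ℕ → ContDiffBump (0 : EuclideanSpace ℝ ι)}
    (hη : Tendsto (fun k => (η k).rOut) atTop (𝓝 0)) (hη1 : ∀ k, (η k).rOut ≤ 1) :
    Tendsto (fun k => ∫ y, ((((η k).normed volume ⋆[lsmul ℝ ℝ, volume] c) y : ℝ) : ℂ) * φ y) atTop
      (𝓝 (∫ y, (c y : ℂ) * φ y)) := by
  obtain ⟨C, hC⟩ := hc.bounded_above_of_compact_support hcc
  have hC0 : 0 ≤ C := (norm_nonneg _).trans (hC 0)
  have hsm : ∀ k, ContDiff ℝ ∞ ((η k).normed volume ⋆[lsmul ℝ ℝ, volume] c) := fun k =>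
    (η k).hasCompactSupport_normed.contDiff_convolution_left _ (η k).contDiff_normed
      hc.locallyIntegrable
  -- All bumps have radius at most 1, so K contains the supports of all the mollifications and
  -- localizes the dominating function.
  set K := cthickening 1 (tsupport c)
  have hK : IsCompact K := hcc.isCompact.cthickening
  refine tendsto_integral_of_dominated_convergence (K.indicator fun y => C * ‖φ y‖)
    (fun k => ?_) ?_ (fun k => Eventually.of_forall fun y => ?_) (Eventually.of_forall fun y => ?_)
  · exact (Complex.continuous_ofReal.comp (hsm k).continuous).aestronglyMeasurable.mul
      hφ.aestronglyMeasurable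
  · rw [integrable_indicator_iff hK.measurableSet]
    exact (hφ.integrableOn_isCompact hK).norm.const_mul C
  · have hbd : ∀ ε, 0 ≤ ε → (∀ x ∈ ball y (η k).rOut, dist (c x) 0 ≤ ε) →
        ‖((η k).normed volume ⋆[lsmul ℝ ℝ, volume] c) y‖ ≤ ε := fun ε hε h => by
      rw [← dist_zero_right]
      exact dist_convolution_le hε (η k).support_normed_eq.subset (η k).nonneg_normed
        (η k).integral_normed hc.aestronglyMeasurable h
    by_cases hy : y ∈ K
    · rw [indicator_of_mem hy, norm_mul, Complex.norm_real]
      exact mul_le_mul_of_nonneg_right (hbd C hC0 fun x _ => by simpa using hC x) (norm_nonneg _)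
    · have h0 := hbd 0 le_rfl fun x hx => by
        have : x ∉ tsupport c := fun hxc => hy (mem_cthickening_of_dist_le y x 1 _ hxc
          (by rw [dist_comm]; exact (mem_ball.1 hx).le.trans (hη1 k)))
        simp [image_eq_zero_of_notMem_tsupport this]
      rw [indicator_of_notMem hy, norm_le_zero_iff.1 h0]
      simp
  · have := ContDiffBump.convolution_tendsto_right_of_continuous (μ := volume) hη hc y
    exact ((Complex.continuous_ofReal.tendsto _).comp this).mul_const _

theorem integrable_ofReal_mul {c : EuclideanSpace ℝ ι → ℝ} (hc : Continuous c)
    (hcc : HasCompactSupport c) {φ : EuclideanSpace ℝ ι → ℂ} (hφ : LocallyIntegrable φ volume) :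
    Integrable (fun y => (c y : ℂ) * φ y) volume := by
  simpa using hφ.integrable_smul_left_of_hasCompactSupport
    (Complex.continuous_ofReal.comp hc) (hcc.comp_left Complex.ofReal_zero)

variable [DecidableEq ι]

/-- A weak gradient can be tested against continuous vector fields of compact support whose weak
divergence is continuous of compact support. -/
theorem PontryaginKoopman.HasWeakGradient.integral_divergence_mul {φ : EuclideanSpace ℝ ι → ℂ}
    {g : EuclideanSpace ℝ ι → ι → ℂ} (h : HasWeakGradient φ g)
    {X : ι → EuclideanSpace ℝ ι → ℝ} {d : EuclideanSpace ℝ ι → ℝ}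
    (hX : ∀ j, Continuous (X j)) (hXc : ∀ j, HasCompactSupport (X j))
    (hd : Continuous d) (hdc : HasCompactSupport d)
    (hdiv : ∀ χ : EuclideanSpace ℝ ι → ℝ, ContDiff ℝ ∞ χ → HasCompactSupport χ →
      ∫ y, d y * χ y = -∑ j, ∫ y, X j y * fderiv ℝ χ y (EuclideanSpace.single j 1)) :
    ∫ y, (d y : ℂ) * φ y = -∑ j, ∫ y, (X j y : ℂ) * g y j := by
  let η : ℕ → ContDiffBump (0 : EuclideanSpace ℝ ι) := fun k =>
    ⟨1 / (k + 1) / 2, 1 / (k + 1), by positivity, half_lt_self (by positivity)⟩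
  have hη : Tendsto (fun k => (η k).rOut) atTop (𝓝 0) := tendsto_one_div_add_atTop_nhds_zero_nat
  have hη1 : ∀ k, (η k).rOut ≤ 1 := fun k => by
    simp only [η]
    rw [div_le_one (by positivity)]
    linarith [(Nat.cast_nonneg k : (0 : ℝ) ≤ k)]
  have hlim := tendsto_integral_convolution_mul hd hdc h.locallyIntegrable hη hη1
  have hlim' := (tendsto_finsetSum Finset.univ fun j _ => tendsto_integral_convolution_mul (hX j)
    (hXc j) (h.locallyIntegrable_gradient j) hη hη1).neg
  refine tendsto_nhds_unique hlim (hlim'.congr fun k => ?_)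
  set m : (EuclideanSpace ℝ ι → ℝ) → EuclideanSpace ℝ ι → ℝ := fun c =>
    (η k).normed volume ⋆[lsmul ℝ ℝ, volume] c
  have hηs : ContDiff ℝ ∞ ((η k).normed volume) := (η k).contDiff_normed
  have hηc : HasCompactSupport ((η k).normed volume) := (η k).hasCompactSupport_normed
  have hsm : ∀ j, ContDiff ℝ ∞ (m (X j)) := fun j =>
    hηc.contDiff_convolution_left _ hηs (hX j).locallyIntegrable
  have hcs : ∀ j, HasCompactSupport (m (X j)) := fun j => hηc.convolution _ (hXc j)
  have hdivm : ∀ y, m d y = ∑ j, fderiv ℝ (m (X j)) y (EuclideanSpace.single j 1) := by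
    intro y
    -- Testing the weak divergence identity with w ↦ η(y - w) shows that mollification commutes with
    -- the divergence. The smooth fields η ⋆ X_j are then admissible in the definition of the weak
    -- gradient.
    have hχ : ContDiff ℝ ∞ fun w => (η k).normed volume (y - w) :=
      hηs.comp (contDiff_const.sub contDiff_id)
    have hχc : HasCompactSupport fun w => (η k).normed volume (y - w) :=
      hηc.comp_homeomorph (Homeomorph.subLeft y)
    have hχd : ∀ w v, fderiv ℝ (fun w => (η k).normed volume (y - w)) w v =
        -fderiv ℝ ((η k).normed volume) (y - w) v := fun w v => by
      have h1 := ((hηs.differentiable (by simp)) (y - w)).hasFDerivAt.comp w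
        ((hasFDerivAt_id w).const_sub y)
      refine (congrArg (· v) h1.fderiv).trans ?_
      simp only [ContinuousLinearMap.comp_apply, _root_.neg_apply, ContinuousLinearMap.id_apply,
        map_neg]
    have := hdiv _ hχ hχc
    simp only [hχd, mul_neg, integral_neg, Finset.sum_neg_distrib, neg_neg] at this
    simp only [m]
    rw [convolution_lsmul_swap]
    simp only [smul_eq_mul]
    simp only [mul_comm (d _)] at this
    rw [this]
    refine Finset.sum_congr rfl fun j _ => ?_
    rw [fderiv_convolution_apply hηs hηc (hX j).locallyIntegrable]
    simp only [mul_comm]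
  have hint : ∀ j, Integrable (fun y =>
      ((fderiv ℝ (m (X j)) y (EuclideanSpace.single j 1) : ℝ) : ℂ) * φ y) volume := fun j =>
    integrable_ofReal_mul (((hsm j).continuous_fderiv (by simp)).clm_apply continuous_const)
      ((hcs j).fderiv_apply ℝ _) h.locallyIntegrable
  calc -∑ j, ∫ y, ((m (X j) y : ℝ) : ℂ) * g y j
      = ∑ j, ∫ y, ((fderiv ℝ (m (X j)) y (EuclideanSpace.single j 1) : ℝ) : ℂ) * φ y := by
        rw [← Finset.sum_neg_distrib]
        exact Finset.sum_congr rfl fun j _ => (h.integral_eq _ (hsm j) (hcs j) j).symm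
    _ = ∫ y, ((m d y : ℝ) : ℂ) * φ y := by
        rw [← integral_finsetSum _ fun j _ => hint j]
        simp only [hdivm, Complex.ofReal_sum, Finset.sum_mul]

/-- The chain rule for weak gradients under a volume preserving `C¹` homeomorphism. -/
theorem PontryaginKoopman.HasWeakGradient.comp_homeomorph {φ : EuclideanSpace ℝ ι → ℂ}
    {g : EuclideanSpace ℝ ι → ι → ℂ} (h : HasWeakGradient φ g)
    (G : EuclideanSpace ℝ ι ≃ₜ EuclideanSpace ℝ ι) (hG : ContDiff ℝ 1 G)
    (hmp : MeasurePreserving G volume volume) :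
    HasWeakGradient (φ ∘ G) fun z i =>
      ∑ j, ((fderiv ℝ G z (EuclideanSpace.single i 1) j : ℝ) : ℂ) * g (G z) j := by
  have hloc : ∀ {u : EuclideanSpace ℝ ι → ℂ}, LocallyIntegrable u volume →
      LocallyIntegrable (u ∘ G) volume := fun {u} hu =>
    (locallyIntegrable_map_homeomorph G).1 (by rwa [hmp.map_eq])
  have hDG : Continuous (fderiv ℝ G) := hG.continuous_fderiv one_ne_zero
  have hDGij : ∀ i j, Continuous fun z => fderiv ℝ G z (EuclideanSpace.single i 1) j := fun i j =>
    (EuclideanSpace.proj (𝕜 := ℝ) j).continuous.comp (hDG.clm_apply continuous_const)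
  have hpull : ∀ {V : Type} [NormedAddCommGroup V] [NormedSpace ℝ V]
      (u : EuclideanSpace ℝ ι → V), ∫ z, u (G z) = ∫ y, u y := fun u =>
    hmp.integral_comp G.measurableEmbedding u
  refine ⟨hloc h.locallyIntegrable, fun i => ?_, fun ψ hψ hψc i => ?_⟩
  · refine locallyIntegrable_finsetSum _ fun j _ => ?_
    exact (hloc (h.locallyIntegrable_gradient j)).continuous_mul
      (Complex.continuous_ofReal.comp (hDGij i j))
  set e : EuclideanSpace ℝ ι := EuclideanSpace.single i 1
  -- X is the push-forward under G of the field ψ eᵢ, and d that of its divergence ∂ᵢψ. Because G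
  -- preserves volume, d is the weak divergence of X, though X is merely continuous.
  let d : EuclideanSpace ℝ ι → ℝ := fun y => fderiv ℝ ψ (G.symm y) e
  let X : ι → EuclideanSpace ℝ ι → ℝ := fun j y => ψ (G.symm y) * fderiv ℝ G (G.symm y) e j
  have hdψ : Continuous fun z => fderiv ℝ ψ z e :=
    (hψ.continuous_fderiv (by simp)).clm_apply continuous_const
  have hdψc : HasCompactSupport fun z => fderiv ℝ ψ z e := hψc.fderiv_apply ℝ e
  have hd : Continuous d := hdψ.comp G.symm.continuous
  have hdc : HasCompactSupport d := hdψc.comp_homeomorph G.symm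
  have hX : ∀ j, Continuous (X j) := fun j =>
    (hψ.continuous.mul (hDGij i j)).comp G.symm.continuous
  have hXc : ∀ j, HasCompactSupport (X j) := fun j =>
    (hψc.mul_right (f' := fun z => fderiv ℝ G z e j)).comp_homeomorph G.symm
  have hXG : ∀ j z, X j (G z) = ψ z * fderiv ℝ G z e j := fun j z => by simp [X]
  have hdG : ∀ z, d (G z) = fderiv ℝ ψ z e := fun z => by simp [d]
  have key := h.integral_divergence_mul hX hXc hd hdc fun χ hχ hχc => by
    have hXpull : ∀ j, ∫ y, X j y * fderiv ℝ χ y (EuclideanSpace.single j 1) =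
        ∫ z, ψ z * fderiv ℝ G z e j * fderiv ℝ χ (G z) (EuclideanSpace.single j 1) := fun j => by
      rw [← hpull fun y => X j y * _]; simp only [hXG]
    rw [← hpull fun y => d y * χ y]
    simp only [hXpull, hdG]
    have hχG : ContDiff ℝ 1 (χ ∘ G) := (hχ.of_le (by simp)).comp hG
    have hder : ∀ z, fderiv ℝ (χ ∘ G) z e =
        ∑ j, fderiv ℝ G z e j * fderiv ℝ χ (G z) (EuclideanSpace.single j 1) := fun z => by
      rw [fderiv_comp z ((hχ.differentiable (by simp)) _) ((hG.differentiable one_ne_zero) z)]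
      conv_lhs =>
        rw [ContinuousLinearMap.comp_apply, ← (EuclideanSpace.basisFun ι ℝ).sum_repr
          (fderiv ℝ G z e)]
      simp
    have hχGc : Continuous fun z => fderiv ℝ (χ ∘ G) z e :=
      (hχG.continuous_fderiv one_ne_zero).clm_apply continuous_const
    -- After pulling back by G, the divergence identity is integration by parts of ψ against the C¹
    -- function χ ∘ G.
    have hparts := integral_mul_fderiv_eq_neg_fderiv_mul_of_integrable (μ := volume)
      (f := ψ) (g := χ ∘ G) (v := e)
      ((hdψ.mul hχG.continuous).integrable_of_hasCompactSupport hdψc.mul_right)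
      ((hψ.continuous.mul hχGc).integrable_of_hasCompactSupport hψc.mul_right)
      ((hψ.continuous.mul hχG.continuous).integrable_of_hasCompactSupport hψc.mul_right)
      (fun z _ => (hψ.differentiable (by simp)) z)
      (fun z _ => (hχG.differentiable one_ne_zero) z)
    rw [eq_comm, neg_eq_iff_eq_neg] at hparts
    refine hparts.trans ?_
    rw [← integral_finsetSum]
    · simp only [hder, Finset.mul_sum, mul_assoc]
    · intro j _
      exact ((hψ.continuous.mul (hDGij i j)).mul (((hχ.continuous_fderiv (by simp)).comp
        G.continuous).clm_apply continuous_const)).integrable_of_hasCompactSupport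
          hψc.mul_right.mul_right
  have hXpull : ∀ j, ∫ y, (X j y : ℂ) * g y j =
      ∫ z, ((ψ z * fderiv ℝ G z e j : ℝ) : ℂ) * g (G z) j := fun j => by
    rw [← hpull fun y => (X j y : ℂ) * _]; simp only [hXG]
  rw [← hpull fun y => (d y : ℂ) * φ y] at key
  simp only [hXpull, hdG] at key
  refine key.trans ?_
  rw [← integral_finsetSum]
  · simp only [Finset.mul_sum, Complex.ofReal_mul, mul_assoc]
  · intro j _
    exact integrable_ofReal_mul (hψ.continuous.mul (hDGij i j)) hψc.mul_right
      (hloc (h.locallyIntegrable_gradient j))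

theorem PontryaginKoopman.HasWeakGradient.ae_eq {φ : EuclideanSpace ℝ ι → ℂ}
    {g g' : EuclideanSpace ℝ ι → ι → ℂ} (h : HasWeakGradient φ g) (h' : HasWeakGradient φ g') :
    g =ᵐ[volume] g' := by
  have : ∀ i, ∀ᵐ z, g z i = g' z i := fun i =>
    ae_eq_of_integral_contDiff_smul_eq (h.locallyIntegrable_gradient i)
      (h'.locallyIntegrable_gradient i) fun ψ hψ hψc => by
        simp only [Complex.real_smul]
        exact neg_injective ((h.integral_eq ψ hψ hψc i).symm.trans (h'.integral_eq ψ hψ hψc i))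
  filter_upwards [ae_all_iff.2 this] with z hz using funext hz

theorem PontryaginKoopman.HasWeakGradient.weakGradient_ae_eq {φ : EuclideanSpace ℝ ι → ℂ}
    {g : EuclideanSpace ℝ ι → ι → ℂ} (h : HasWeakGradient φ g) :
    weakGradient φ =ᵐ[volume] g := by
  have hφ : WeaklyDifferentiable φ := ⟨g, h⟩
  rw [weakGradient, dif_pos hφ]
  exact hφ.choose_spec.ae_eq h

end WeakChainRule

/-! ### Regularity of the minimizer -/

section ImplicitMinimizer

variable {Q U : Type*} [NormedAddCommGroup Q] [NormedSpace ℝ Q]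
  [NormedAddCommGroup U] [NormedSpace ℝ U]

/-- Positivity excludes a kernel, and U and its dual have the same dimension. -/
theorem ContinuousLinearMap.isInvertible_of_pos [FiniteDimensional ℝ U] (A : U →L[ℝ] U →L[ℝ] ℝ)
    (hA : ∀ v, v ≠ 0 → 0 < A v v) : A.IsInvertible := by
  have hinj : Function.Injective (A : U →ₗ[ℝ] U →L[ℝ] ℝ) := by
    refine (injective_iff_map_eq_zero _).2 fun v hv => ?_
    by_contra hne
    have h0 : A v = 0 := hv
    have := hA v hne
    simp [h0] at this
  have hrank : Module.finrank ℝ U = Module.finrank ℝ (U →L[ℝ] ℝ) := by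
    rw [← (LinearMap.toContinuousLinearMap (𝕜 := ℝ) (E := U) (F' := ℝ)).finrank_eq]
    exact (Subspace.dual_finrank_eq (K := ℝ) (V := U)).symm
  refine ⟨(LinearEquiv.ofInjectiveOfFinrankEq (A : U →ₗ[ℝ] U →L[ℝ] ℝ) hinj
    hrank).toContinuousLinearEquiv, ?_⟩
  ext v w
  rfl

theorem fderiv_prodMk_right {H : Q × U → ℝ} (hH : ContDiff ℝ 2 H) (q : Q) (u : U) :
    fderiv ℝ (fun w => H (q, w)) u = (fderiv ℝ H (q, u)).comp (.inr ℝ Q U) :=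
  (((hH.differentiable two_ne_zero) (q, u)).hasFDerivAt.comp u
    (hasFDerivAt_prodMk_right q u)).fderiv

/-- The first-order condition H_u = 0 serves twice: as the equation for the implicit function
theorem and as the vanishing term in the envelope identity. -/
theorem fderiv_inr_minimizer {H : Q × U → ℝ} (hH : ContDiff ℝ 2 H) {u : Q → U}
    (hmin : ∀ q v, H (q, u q) ≤ H (q, v)) (q : Q) :
    (fderiv ℝ H (q, u q)).comp (.inr ℝ Q U) = 0 := by
  rw [← fderiv_prodMk_right hH]
  exact IsLocalMin.fderiv_eq_zero (Filter.Eventually.of_forall fun v => hmin q v)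

/-- A continuous choice of nondegenerate minimizers of a `C²` function is `C¹`. -/
theorem contDiff_minimizer [FiniteDimensional ℝ Q] [FiniteDimensional ℝ U] {H : Q × U → ℝ} (hH : ContDiff ℝ 2 H) {u : Q → U} (hu : Continuous u)
    (hmin : ∀ q v, H (q, u q) ≤ H (q, v))
    (hpos : ∀ q v, v ≠ 0 → 0 < fderiv ℝ (fderiv ℝ fun w => H (q, w)) (u q) v v) :
    ContDiff ℝ 1 u := by
  have : CompleteSpace Q := FiniteDimensional.complete ℝ Q
  have : CompleteSpace U := FiniteDimensional.complete ℝ U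
  let G : Q × U → U →L[ℝ] ℝ := fun p => (fderiv ℝ H p).comp (.inr ℝ Q U)
  have hG : ContDiff ℝ 1 G :=
    (hH.fderiv_right (m := 1) (by norm_num)).clm_comp contDiff_const
  refine contDiff_iff_contDiffAt.2 fun q => ?_
  have hinv : ((fderiv ℝ G (q, u q)).comp (.inr ℝ Q U)).IsInvertible := by
    refine ContinuousLinearMap.isInvertible_of_pos _ fun v hv => ?_
    have h1 := (((hG.differentiable one_ne_zero) (q, u q)).hasFDerivAt.comp (u q)
      (hasFDerivAt_prodMk_right q (u q))).fderiv
    have h2 : G ∘ (fun w => (q, w)) = fderiv ℝ fun w => H (q, w) :=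
      funext fun w => (fderiv_prodMk_right hH q w).symm
    rw [h2] at h1
    have := hpos q v hv
    rwa [h1] at this
  have hGa : ContDiffAt ℝ 1 G (q, u q) := hG.contDiffAt
  refine (hGa.contDiffAt_implicitFunction one_ne_zero hinv).congr_of_eventuallyEq ?_
  -- The implicit function describes only the solutions near (q, u q); continuity of u places (q', u
  -- q') there.
  have htend : Filter.Tendsto (fun q' => (q', u q')) (nhds q) (nhds (q, u q)) :=
    (continuous_id.prodMk hu).tendsto q
  filter_upwards [htend.eventually
    (hGa.eventually_apply_eq_iff_implicitFunction one_ne_zero hinv)] with q' hq'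
  refine (hq'.1 ?_).symm
  exact (fderiv_inr_minimizer hH hmin q').trans (fderiv_inr_minimizer hH hmin q).symm

end ImplicitMinimizer

/-! ### Pontryagin's field as a Hamiltonian vector field -/

namespace PontryaginKoopman

variable {n m : ℕ}

/-- The state component as a continuous linear map. -/
noncomputable def stateL (n : ℕ) : Phase n →L[ℝ] Vec n :=
  LinearMap.toContinuousLinearMap
    { toFun := state, map_add' := fun _ _ => rfl, map_smul' := fun _ _ => rfl }

/-- The co-state component as a continuous linear map. -/
noncomputable def costateL (n : ℕ) : Phase n →L[ℝ] Vec n :=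
  LinearMap.toContinuousLinearMap
    { toFun := costate, map_add' := fun _ _ => rfl, map_smul' := fun _ _ => rfl }

/-- Stacking two vectors, as a continuous linear map. -/
noncomputable def stackL (n : ℕ) : Vec n × Vec n →L[ℝ] Phase n :=
  LinearMap.toContinuousLinearMap
    { toFun := fun q => stack q.1 q.2
      map_add' := fun _ _ => by ext (i | i) <;> rfl
      map_smul' := fun _ _ => by ext (i | i) <;> rfl }

@[simp] theorem state_stack (x p : Vec n) : state (stack x p) = x := rfl

@[simp] theorem costate_stack (x p : Vec n) : costate (stack x p) = p := rfl

/-- The standard symplectic form `⟪a₁, b₂⟫ - ⟪a₂, b₁⟫` on phase space. -/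
noncomputable def symplecticForm (n : ℕ) : Phase n →L[ℝ] Phase n →L[ℝ] ℝ :=
  (innerSL ℝ).bilinearComp (stateL n) (costateL n) -
    (innerSL ℝ).bilinearComp (costateL n) (stateL n)

theorem symplecticForm_apply (a b : Phase n) :
    symplecticForm n a b = inner ℝ (state a) (costate b) - inner ℝ (costate a) (state b) := rfl

theorem symplecticForm_swap (a b : Phase n) :
    symplecticForm n a b = -symplecticForm n b a := by
  rw [symplecticForm_apply, symplecticForm_apply, real_inner_comm (state a),
    real_inner_comm (costate a)]
  ring

/-- The Hamiltonian as a function of `((x, λ), u)`. -/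
noncomputable def jointHamiltonian (f : Vec n × Vec m → Vec n) (l : Vec n × Vec m → ℝ)
    (q : (Vec n × Vec n) × Vec m) : ℝ :=
  hamiltonian f l q.1.1 q.2 q.1.2

variable {f : Vec n × Vec m → Vec n} {l : Vec n × Vec m → ℝ} {ustar : Vec n → Vec n → Vec m}

theorem contDiff_jointHamiltonian (hf : DynamicsAssumption f) (hl : CostAssumption l) :
    ContDiff ℝ 2 (jointHamiltonian f l) := by
  have hf' := hf.contDiff
  have hl' : ContDiff ℝ 2 l := hl
  have hxu : ContDiff ℝ 2 fun q : (Vec n × Vec n) × Vec m => (q.1.1, q.2) := by fun_prop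
  exact (contDiff_fst.snd.inner ℝ (hf'.comp hxu)).add (hl'.comp hxu)

theorem contDiff_ustar (hf : DynamicsAssumption f) (hl : CostAssumption l)
    (hu : MinimizerAssumption f l ustar) :
    ContDiff ℝ 1 fun q : Vec n × Vec n => ustar q.1 q.2 :=
  contDiff_minimizer (contDiff_jointHamiltonian hf hl) hu.continuous
    (fun q v => hu.minimizer q.1 q.2 v) (fun q v hv => hu.secondOrder q.1 q.2 v hv)

/-- Writing the partial derivative as a restriction of the full one exposes its C¹ dependence on all
variables, including the control. -/
theorem fderiv_hamiltonian_state (hf : DynamicsAssumption f) (hl : CostAssumption l)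
    (x : Vec n) (u : Vec m) (p : Vec n) :
    fderiv ℝ (fun x => hamiltonian f l x u p) x =
      (fderiv ℝ (jointHamiltonian f l) ((x, p), u)).comp
        ((ContinuousLinearMap.inl ℝ (Vec n × Vec n) (Vec m)).comp (.inl ℝ (Vec n) (Vec n))) :=
  (HasFDerivAt.comp (g := jointHamiltonian f l) (f := fun x => ((x, p), u)) x
    (((contDiff_jointHamiltonian hf hl).differentiable two_ne_zero) ((x, p), u)).hasFDerivAt
    (HasFDerivAt.comp (g := fun q : Vec n × Vec n => (q, u)) x (hasFDerivAt_prodMk_left (x, p) u)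
      (hasFDerivAt_prodMk_left x p))).fderiv

/-- The point `((x, λ), u⋆(x, λ))` at which the Hamiltonian is evaluated. -/
def optimalPoint (ustar : Vec n → Vec n → Vec m) (y : Phase n) : (Vec n × Vec n) × Vec m :=
  ((state y, costate y), ustar (state y) (costate y))

theorem contDiff_optimalPoint (hf : DynamicsAssumption f) (hl : CostAssumption l)
    (hu : MinimizerAssumption f l ustar) : ContDiff ℝ 1 (optimalPoint ustar) := by
  have h : ContDiff ℝ 1 fun y : Phase n => (state y, costate y) :=
    (stateL n).contDiff.prodMk (costateL n).contDiff
  exact h.prodMk ((contDiff_ustar hf hl hu).comp h)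

theorem contDiff_pontryaginField (hf : DynamicsAssumption f) (hl : CostAssumption l)
    (hu : MinimizerAssumption f l ustar) : ContDiff ℝ 1 (pontryaginField f l ustar) := by
  have hO := contDiff_optimalPoint hf hl hu
  have h1 : ContDiff ℝ 1 fun y : Phase n => f (state y, ustar (state y) (costate y)) :=
    (hf.contDiff.of_le one_le_two).comp (hO.fst.fst.prodMk hO.snd)
  have h2 : ContDiff ℝ 1 fun y : Phase n =>
      gradient (fun x => hamiltonian f l x (ustar (state y) (costate y)) (costate y)) (state y) := by
    simp only [gradient, fderiv_hamiltonian_state hf hl]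
    refine (InnerProductSpace.toDual ℝ (Vec n)).symm.toContinuousLinearEquiv.contDiff.comp ?_
    exact (((contDiff_jointHamiltonian hf hl).fderiv_right (m := 1) (by norm_num)).comp
      hO).clm_comp contDiff_const
  exact (stackL n).contDiff.comp (h1.prodMk h2.neg)

/-- Envelope theorem: the term H_u ∘ Du⋆ vanishes, and the rest, ⟨∇ₓH, b_x⟩ + ⟨f, b_λ⟩, is σ(F, b)
because F = (f, -∇ₓH). -/
theorem hasFDerivAt_minimized_hamiltonian (hf : DynamicsAssumption f) (hl : CostAssumption l)
    (hu : MinimizerAssumption f l ustar) (y : Phase n) :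
    HasFDerivAt (fun y => jointHamiltonian f l (optimalPoint ustar y))
      (symplecticForm n (pontryaginField f l ustar y)) y := by
  have hH := contDiff_jointHamiltonian hf hl
  have hO := contDiff_optimalPoint hf hl hu
  have hus := contDiff_ustar hf hl hu
  set D := fderiv ℝ (jointHamiltonian f l) (optimalPoint ustar y) with hD
  have hpt : HasFDerivAt (fun y : Phase n => (state y, costate y))
      ((stateL n).prod (costateL n)) y :=
    (stateL n).hasFDerivAt.prodMk (costateL n).hasFDerivAt
  obtain ⟨V, hV⟩ : ∃ V : Phase n →L[ℝ] Vec m,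
      HasFDerivAt (fun y => ustar (state y) (costate y)) V y :=
    ⟨_, HasFDerivAt.comp (g := fun q : Vec n × Vec n => ustar q.1 q.2) y
      ((hus.differentiable one_ne_zero) (state y, costate y)).hasFDerivAt hpt⟩
  have hmain := ((hH.differentiable two_ne_zero) (optimalPoint ustar y)).hasFDerivAt.comp y
    (hpt.prodMk hV)
  refine hmain.congr_fderiv ?_
  ext b
  have hx : D ((state b, 0), 0) = inner ℝ (gradient (fun x => hamiltonian f l x
      (ustar (state y) (costate y)) (costate y)) (state y)) (state b) := by
    rw [gradient, InnerProductSpace.toDual_symm_apply, fderiv_hamiltonian_state hf hl]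
    rfl
  have hp : D ((0, costate b), 0) =
      inner ℝ (f (state y, ustar (state y) (costate y))) (costate b) := by
    have h1 := HasFDerivAt.comp (g := jointHamiltonian f l)
      (f := fun p => ((state y, p), ustar (state y) (costate y))) (costate y)
      ((hH.differentiable two_ne_zero) (optimalPoint ustar y)).hasFDerivAt
      (HasFDerivAt.comp (g := fun q : Vec n × Vec n => (q, ustar (state y) (costate y)))
        (costate y)
        (hasFDerivAt_prodMk_left (state y, costate y) (ustar (state y) (costate y)))
        (hasFDerivAt_prodMk_right (state y) (costate y)))
    have h2 : HasFDerivAt (fun p => hamiltonian f l (state y) (ustar (state y) (costate y)) p)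
        (innerSL ℝ (f (state y, ustar (state y) (costate y)))) (costate y) := by
      have := ((innerSL ℝ (f (state y, ustar (state y) (costate y)))).hasFDerivAt
        (x := costate y)).add_const (l (state y, ustar (state y) (costate y)))
      refine this.congr_of_eventuallyEq (Filter.Eventually.of_forall fun p => ?_)
      simp [hamiltonian, real_inner_comm]
    exact congrArg (· (costate b)) (h1.unique h2)
  have hv : D ((0, 0), V b) = 0 :=
    congrArg (· (V b)) (fderiv_inr_minimizer hH (u := fun q : Vec n × Vec n => ustar q.1 q.2)
      (fun q v => hu.minimizer q.1 q.2 v) (state y, costate y))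
  have hsum : (((state b, costate b), V b) : (Vec n × Vec n) × Vec m) =
      ((state b, 0), 0) + ((0, costate b), 0) + ((0, 0), V b) := by simp
  change D ((state b, costate b), V b) = _
  rw [hsum, map_add, map_add, hx, hp, hv, symplecticForm_apply, pontryaginField, state_stack,
    costate_stack, inner_neg_left]
  ring

/-- Pontryagin's vector field is Hamiltonian: it leaves the symplectic form infinitesimally
invariant. -/
theorem symplecticForm_fderiv_pontryaginField (hf : DynamicsAssumption f) (hl : CostAssumption l)
    (hu : MinimizerAssumption f l ustar) (y a b : Phase n) :
    symplecticForm n (fderiv ℝ (pontryaginField f l ustar) y a) b +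
      symplecticForm n a (fderiv ℝ (pontryaginField f l ustar) y b) = 0 := by
  have hF := ((contDiff_pontryaginField hf hl hu).differentiable one_ne_zero y).hasFDerivAt
  -- The second derivative of the minimized Hamiltonian is σ(DF a, b). Its symmetry in a and b, with
  -- the antisymmetry of σ, is the claim.
  have := second_derivative_symmetric (hasFDerivAt_minimized_hamiltonian hf hl hu)
    ((symplecticForm n).hasFDerivAt.comp y hF) a b
  rw [symplecticForm_swap a]
  simp only [ContinuousLinearMap.comp_apply] at this
  rw [this, add_neg_cancel]

end PontryaginKoopman

/-! ### Symplectic diffeomorphisms acting on Sobolev functions -/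

namespace PontryaginKoopman

variable {n : ℕ}

/-- The Jacobian matrix of a linear endomorphism of phase space. -/
noncomputable def jacobian (D : Phase n →L[ℝ] Phase n) : Matrix (Fin n ⊕ Fin n) (Fin n ⊕ Fin n) ℝ :=
  Matrix.of fun i j => D (EuclideanSpace.single j 1) i

theorem det_jacobian (D : Phase n →L[ℝ] Phase n) : (jacobian D).det = D.det := by
  have : jacobian D = LinearMap.toMatrix (EuclideanSpace.basisFun _ ℝ).toBasis
      (EuclideanSpace.basisFun _ ℝ).toBasis (D : Phase n →ₗ[ℝ] Phase n) := by
    ext i j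
    simp [jacobian, LinearMap.toMatrix_apply]
  rw [this, LinearMap.det_toMatrix]

/-- `Matrix.J` has blocks (0, -I; I, 0), whence the sign. -/
theorem dotProduct_J_mulVec (a b : Phase n) :
    (fun i => a i) ⬝ᵥ (Matrix.J (Fin n) ℝ *ᵥ fun i => b i) = -symplecticForm n a b := by
  simp only [symplecticForm_apply, Matrix.J, dotProduct, Matrix.mulVec, Fintype.sum_sum_type,
    Matrix.fromBlocks_apply₁₁, Matrix.fromBlocks_apply₁₂, Matrix.fromBlocks_apply₂₁,
    Matrix.fromBlocks_apply₂₂, Matrix.zero_apply, Matrix.neg_apply, Matrix.one_apply,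
    PiLp.inner_apply, state, costate]
  simp only [zero_mul, Finset.sum_const_zero, zero_add, neg_mul, ite_mul, one_mul,
    Finset.sum_neg_distrib, Finset.sum_ite_eq, Finset.mem_univ, add_zero]
  simp [mul_comm]
  ring

/-- Up to sign, the entries of MᵀJM are σ(D eᵢ, D eⱼ); the same formula for the identity gives the
entries of J. -/
theorem jacobian_mem_symplecticGroup {D : Phase n →L[ℝ] Phase n}
    (hD : ∀ a b, symplecticForm n (D a) (D b) = symplecticForm n a b) :
    jacobian D ∈ Matrix.symplecticGroup (Fin n) ℝ := by
  have key : ∀ D : Phase n →L[ℝ] Phase n, ∀ i j,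
      ((jacobian D)ᵀ * Matrix.J (Fin n) ℝ * jacobian D) i j =
        -symplecticForm n (D (EuclideanSpace.single i 1)) (D (EuclideanSpace.single j 1)) :=
    fun D i j => by
      rw [Matrix.mul_mul_apply, ← dotProduct_J_mulVec]
      rfl
  have h1 : jacobian (ContinuousLinearMap.id ℝ (Phase n)) = 1 := by
    ext i j
    simp [jacobian, Matrix.one_apply]
  rw [SymplecticGroup.mem_iff']
  ext i j
  rw [key, hD]
  have := key (ContinuousLinearMap.id ℝ (Phase n)) i j
  rw [h1] at this
  simpa using this.symm

theorem Omega_eq_neg_J : Omega n = -Matrix.J (Fin n) ℂ := by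
  rw [Omega, Matrix.J, Matrix.fromBlocks_neg]
  simp

/-- Gradients transform by Mᵀ, so the relation needed is M Ω Mᵀ = Ω rather than Mᵀ Ω M = Ω; the two
are equivalent in the symplectic group. -/
theorem dotProduct_Omega_mulVec_transpose {D : Phase n →L[ℝ] Phase n}
    (hD : ∀ a b, symplecticForm n (D a) (D b) = symplecticForm n a b)
    (v w : Fin n ⊕ Fin n → ℂ) :
    (((jacobian D).map Complex.ofRealHom)ᵀ *ᵥ v) ⬝ᵥ
      (Omega n *ᵥ (((jacobian D).map Complex.ofRealHom)ᵀ *ᵥ w)) = v ⬝ᵥ (Omega n *ᵥ w) := by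
  have hM := SymplecticGroup.map_mem (f := Complex.ofRealHom) (jacobian_mem_symplecticGroup hD)
  rw [SymplecticGroup.mem_iff] at hM
  set M := (jacobian D).map Complex.ofRealHom
  have hΩ : M * Omega n * Mᵀ = Omega n := by
    rw [Omega_eq_neg_J, Matrix.mul_neg, Matrix.neg_mul, hM]
  rw [Matrix.mulVec_transpose M v, ← Matrix.dotProduct_mulVec, Matrix.mulVec_mulVec,
    Matrix.mulVec_mulVec, hΩ]

/-- A `C¹` diffeomorphism of phase space whose derivative preserves the symplectic form. -/
structure IsSymplectic (G : Phase n ≃ₜ Phase n) : Prop where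
  contDiff : ContDiff ℝ 1 G
  form_eq : ∀ z a b, symplecticForm n (fderiv ℝ G z a) (fderiv ℝ G z b) = symplecticForm n a b

variable {G : Phase n ≃ₜ Phase n}

/-- Liouville's theorem. -/
theorem IsSymplectic.measurePreserving (hG : IsSymplectic G) :
    MeasurePreserving G volume volume := by
  refine ⟨G.measurable, Measure.ext fun s hs => ?_⟩
  rw [Measure.map_apply G.measurable hs]
  have := lintegral_abs_det_fderiv_eq_addHaar_image volume (G.measurable hs)
    (fun z _ => ((hG.contDiff.differentiable one_ne_zero) z).hasFDerivAt.hasFDerivWithinAt)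
    G.injective.injOn
  rw [Set.image_preimage_eq s G.surjective] at this
  rw [← this]
  simp [← det_jacobian, SymplecticGroup.det_eq_one (jacobian_mem_symplecticGroup (hG.form_eq _))]

/-- The weak gradient of a composition with a symplectic diffeomorphism. -/
theorem IsSymplectic.hasWeakGradient_comp (hG : IsSymplectic G) {φ : Phase n → ℂ}
    {g : Phase n → Fin n ⊕ Fin n → ℂ} (h : HasWeakGradient φ g) :
    HasWeakGradient (φ ∘ G) fun z =>
      ((jacobian (fderiv ℝ G z)).map Complex.ofRealHom)ᵀ *ᵥ g (G z) :=
  h.comp_homeomorph G hG.contDiff hG.measurePreserving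

/-- Bounded Jacobian entries multiply L₂ gradients into L₂; volume preservation handles the
composition. -/
theorem IsSymplectic.memW12_comp (hG : IsSymplectic G) {C : ℝ}
    (hC : ∀ z i j, |fderiv ℝ G z (EuclideanSpace.single i 1) j| ≤ C)
    {φ : Phase n → ℂ} (hφ : MemW12 φ) : MemW12 (φ ∘ G) := by
  obtain ⟨hφ2, g, hg, hg2⟩ := hφ
  have hmp := hG.measurePreserving
  refine ⟨hφ2.comp_measurePreserving hmp, _, hg.comp_homeomorph G hG.contDiff hmp, fun i => ?_⟩
  refine memLp_finsetSum _ fun j _ => ?_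
  have hc : Continuous fun z => fderiv ℝ G z (EuclideanSpace.single i 1) j :=
    (EuclideanSpace.proj (𝕜 := ℝ) j).continuous.comp
      ((hG.contDiff.continuous_fderiv one_ne_zero).clm_apply continuous_const)
  have hgG : MemLp (fun z => g (G z) j) 2 volume := (hg2 j).comp_measurePreserving hmp
  refine hgG.of_le_mul (c := C)
    ((Complex.continuous_ofReal.comp hc).aestronglyMeasurable.mul hgG.1)
    (Filter.Eventually.of_forall fun z => ?_)
  rw [norm_mul, Complex.norm_real]
  exact mul_le_mul_of_nonneg_right (hC z i j) (norm_nonneg _)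

theorem abs_apply_le_norm (v : Phase n) (j : Fin n ⊕ Fin n) : |v j| ≤ ‖v‖ :=
  PiLp.norm_apply_le v j

/-- Coordinates are pairings with conjugate basis vectors, so bounds on σ become bounds on matrix
entries. -/
theorem abs_apply_eq_abs_symplecticForm (v : Phase n) (j : Fin n ⊕ Fin n) :
    |v j| = |symplecticForm n v (EuclideanSpace.single j.swap 1)| := by
  rcases j with k | k <;>
    simp [symplecticForm_apply, PiLp.inner_apply, state, costate]

/-- No Lipschitz bound on the inverse is assumed: σ(D⁻¹eᵢ, e) = σ(eᵢ, D e) bounds the entries of D⁻¹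
by ‖σ‖ K. -/
theorem IsSymplectic.symm_memW12_comp (hG : IsSymplectic G) (hG' : IsSymplectic G.symm)
    {K : NNReal} (hK : LipschitzWith K G) {φ : Phase n → ℂ} (hφ : MemW12 φ) :
    MemW12 (φ ∘ G.symm) := by
  refine hG'.memW12_comp (C := ‖symplecticForm n‖ * K) (fun y i j => ?_) hφ
  obtain ⟨z, rfl⟩ := G.surjective y
  set e : Phase n := EuclideanSpace.single j.swap 1
  have hcomp : fderiv ℝ G.symm (G z) (fderiv ℝ G z e) = e := by
    have h1 := ((hG'.contDiff.differentiable one_ne_zero) (G z)).hasFDerivAt.comp z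
      ((hG.contDiff.differentiable one_ne_zero) z).hasFDerivAt
    rw [G.symm_comp_self] at h1
    exact congrArg (· e) (h1.unique (hasFDerivAt_id z))
  rw [abs_apply_eq_abs_symplecticForm]
  change |symplecticForm n _ e| ≤ _
  nth_rw 1 [← hcomp]
  rw [hG'.form_eq, ← Real.norm_eq_abs]
  refine ((symplecticForm n).le_opNorm₂ _ _).trans ?_
  have h1 : ‖fderiv ℝ G z e‖ ≤ K := by
    have := (fderiv ℝ G z).le_of_opNorm_le (norm_fderiv_le_of_lipschitz ℝ hK (x₀ := z)) e
    simpa [e] using this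
  have h2 : ‖(EuclideanSpace.single i 1 : Phase n)‖ = 1 := by simp
  rw [h2, mul_one]
  exact mul_le_mul_of_nonneg_left h1 (symplecticForm n).opNorm_nonneg

/-- `weakGradient` is an arbitrary choice; almost everywhere uniqueness transfers square
integrability to it. -/
theorem MemW12.exists_weakGradient_memLp {φ : Phase n → ℂ} (hφ : MemW12 φ) :
    HasWeakGradient φ (weakGradient φ) ∧ ∀ i, MemLp (fun z => weakGradient φ z i) 2 volume := by
  obtain ⟨-, g, hg, hg2⟩ := hφ
  refine ⟨?_, fun i => (memLp_congr_ae ?_).1 (hg2 i)⟩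
  · have h : WeaklyDifferentiable φ := ⟨g, hg⟩
    rw [weakGradient, dif_pos h]
    exact h.choose_spec
  · filter_upwards [hg.weakGradient_ae_eq] with z hz
    rw [hz]

theorem integrable_dotProduct_Omega_mulVec {g h : Phase n → Fin n ⊕ Fin n → ℂ}
    (hg : ∀ i, MemLp (fun z => g z i) 2 volume) (hh : ∀ i, MemLp (fun z => h z i) 2 volume) :
    Integrable (fun z => g z ⬝ᵥ (Omega n *ᵥ h z)) volume := by
  simp only [dotProduct, Matrix.mulVec]
  refine integrable_finsetSum _ fun i _ => ?_
  have : MemLp (fun z => ∑ j, Omega n i j * h z j) 2 volume :=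
    memLp_finsetSum _ fun j _ => (hh j).const_mul _
  exact (hg i).integrable_mul this

/-- The Jacobians cancel pointwise, so no bound on the derivative of G enters. -/
theorem IsSymplectic.omegaIntegrand_comp (hG : IsSymplectic G) {φ Φ : Phase n → ℂ}
    (hφ : MemW12 φ) (hΦ : MemW12 Φ) :
    omegaIntegrand (φ ∘ G) (Φ ∘ G) =ᵐ[volume] omegaIntegrand φ Φ ∘ G := by
  filter_upwards [(hG.hasWeakGradient_comp hφ.exists_weakGradient_memLp.1).weakGradient_ae_eq,
    (hG.hasWeakGradient_comp hΦ.exists_weakGradient_memLp.1).weakGradient_ae_eq] with z h1 h2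
  simp only [omegaIntegrand, Function.comp_apply]
  rw [h1, h2, dotProduct_Omega_mulVec_transpose (hG.form_eq z)]

theorem IsSymplectic.omegaHermIntegrand_comp (hG : IsSymplectic G) {φ Φ : Phase n → ℂ}
    (hφ : MemW12 φ) (hΦ : MemW12 Φ) :
    omegaHermIntegrand (φ ∘ G) (Φ ∘ G) =ᵐ[volume] omegaHermIntegrand φ Φ ∘ G := by
  filter_upwards [(hG.hasWeakGradient_comp hφ.exists_weakGradient_memLp.1).weakGradient_ae_eq,
    (hG.hasWeakGradient_comp hΦ.exists_weakGradient_memLp.1).weakGradient_ae_eq] with z h1 h2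
  simp only [omegaHermIntegrand, Function.comp_apply]
  -- The Jacobian is real, so it commutes with conjugation and the bilinear cancellation applies to
  -- `star v`.
  have hstar : ∀ (D : Phase n →L[ℝ] Phase n) v,
      star (((jacobian D).map Complex.ofRealHom)ᵀ *ᵥ v) =
        ((jacobian D).map Complex.ofRealHom)ᵀ *ᵥ star v := fun D v => by
    ext i
    simp [Matrix.mulVec, dotProduct]
  rw [h1, h2, hstar, dotProduct_Omega_mulVec_transpose (hG.form_eq z)]

/-! ### The Pontryagin flow and the main theorem -/

variable {m : ℕ} {f : Vec n × Vec m → Vec n} {l : Vec n × Vec m → ℝ}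
  {ustar : Vec n → Vec n → Vec m} {Γ : ℝ → Phase n → Phase n}

theorem contDiff_flow (hf : DynamicsAssumption f) (hl : CostAssumption l)
    (hu : MinimizerAssumption f l ustar) (hΓ : IsFlowOf (pontryaginField f l ustar) Γ) (t : ℝ) :
    ContDiff ℝ 1 (Γ t) ∧ ∀ z a b,
      symplecticForm n (fderiv ℝ (Γ t) z a) (fderiv ℝ (Γ t) z b) = symplecticForm n a b := by
  choose D hD hform using exists_hasStrictFDerivAt_flow (contDiff_pontryaginField hf hl hu)
    hΓ.hasDerivAt hΓ.zero (symplecticForm n) (symplecticForm_fderiv_pontryaginField hf hl hu) t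
  refine ⟨contDiff_one_of_hasStrictFDerivAt hD, fun z a b => ?_⟩
  rw [(hD z).hasFDerivAt.fderiv]
  exact hform z a b

/-- The time-`t` map of Pontryagin's differential equation is a symplectic diffeomorphism. -/
theorem exists_isSymplectic_flow (hf : DynamicsAssumption f) (hl : CostAssumption l)
    (hu : MinimizerAssumption f l ustar) (hΓ : IsFlowOf (pontryaginField f l ustar) Γ) (t : ℝ) :
    ∃ G : Phase n ≃ₜ Phase n, ⇑G = Γ t ∧ IsSymplectic G ∧ IsSymplectic G.symm := by
  have hF := contDiff_pontryaginField hf hl hu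
  obtain ⟨h1, h1'⟩ := contDiff_flow hf hl hu hΓ t
  obtain ⟨h2, h2'⟩ := contDiff_flow hf hl hu hΓ (-t)
  let G : Phase n ≃ₜ Phase n :=
    { toFun := Γ t
      invFun := Γ (-t)
      left_inv := flow_neg_flow hF hΓ.hasDerivAt hΓ.zero t
      right_inv := fun z => by simpa using flow_neg_flow hF hΓ.hasDerivAt hΓ.zero (-t) z
      continuous_toFun := h1.continuous
      continuous_invFun := h2.continuous }
  exact ⟨G, rfl, ⟨h1, h1'⟩, ⟨h2, h2'⟩⟩

end PontryaginKoopman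

theorem mainTheorem2 {n m : ℕ}
    (f : Vec n × Vec m → Vec n)
    (l : Vec n × Vec m → ℝ)
    (ustar : Vec n → Vec n → Vec m)
    (Γ : ℝ → Phase n → Phase n)
    (hf : DynamicsAssumption f)
    (hl : CostAssumption l)
    (hu : MinimizerAssumption f l ustar)
    (hΓ : IsFlowOf (pontryaginField f l ustar) Γ)
    (t : ℝ) :
    -- `U_t` respects equality almost everywhere
    (∀ φ Φ : Phase n → ℂ, φ =ᵐ[volume] Φ →
      koopman Γ t φ =ᵐ[volume] koopman Γ t Φ) ∧
    -- `U_t φ` is square integrable and weakly differentiable for every `φ` in `W_{1,2}`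
    (∀ φ : Phase n → ℂ, MemW12 φ →
      MemLp (koopman Γ t φ) 2 volume ∧
      WeaklyDifferentiable (koopman Γ t φ)) ∧
    -- if `Γ_t` is Lipschitz, then `U_t` maps `W_{1,2}` to itself (and nothing else into it)
    ((∃ K, LipschitzWith K (Γ t)) → ∀ φ : Phase n → ℂ,
      MemW12 φ ↔ MemW12 (koopman Γ t φ)) ∧
    -- `U_t` preserves the symplectic form, and the integrals on both sides converge absolutely
    (∀ φ Φ : Phase n → ℂ,
      MemW12 φ → MemW12 Φ →
      Integrable (omegaIntegrand φ Φ) volume ∧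
      Integrable (omegaIntegrand
        (koopman Γ t φ) (koopman Γ t Φ)) volume ∧
      omega (koopman Γ t φ) (koopman Γ t Φ) =
        omega φ Φ ∧
      Integrable (omegaHermIntegrand φ Φ) volume ∧
      Integrable (omegaHermIntegrand
        (koopman Γ t φ) (koopman Γ t Φ)) volume ∧
      omegaHerm
          (koopman Γ t φ) (koopman Γ t Φ) =
        omegaHerm φ Φ) := by

  obtain ⟨G, hGΓ, hG, hG'⟩ := exists_isSymplectic_flow hf hl hu hΓ t
  have hk : ∀ φ, koopman Γ t φ = φ ∘ G := fun φ => by rw [hGΓ]; rfl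
  have hmp := hG.measurePreserving
  simp only [hk, ← hGΓ]
  refine ⟨fun φ Φ h => hmp.quasiMeasurePreserving.ae_eq_comp h, fun φ hφ => ?_, ?_,
    fun φ Φ hφ hΦ => ?_⟩
  · exact ⟨hφ.1.comp_measurePreserving hmp, _,
      hG.hasWeakGradient_comp hφ.exists_weakGradient_memLp.1⟩
  · rintro ⟨K, hK⟩ φ
    refine ⟨fun hφ => hG.memW12_comp (C := K) (fun z i j => ?_) hφ, fun hφ => ?_⟩
    · refine (abs_apply_le_norm _ j).trans ?_
      simpa using (fderiv ℝ G z).le_of_opNorm_le (norm_fderiv_le_of_lipschitz ℝ hK (x₀ := z))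
        (EuclideanSpace.single i 1)
    -- The converse recovers φ as (φ ∘ G) ∘ G⁻¹.
    · have := hG.symm_memW12_comp hG' hK hφ
      rwa [Function.comp_assoc, G.self_comp_symm, Function.comp_id] at this
  · have hφg := hφ.exists_weakGradient_memLp.2
    have hΦg := hΦ.exists_weakGradient_memLp.2
    have hint : Integrable (omegaIntegrand φ Φ) volume :=
      integrable_dotProduct_Omega_mulVec hφg hΦg
    have hintH : Integrable (omegaHermIntegrand φ Φ) volume :=
      integrable_dotProduct_Omega_mulVec (fun i => (hφg i).star) hΦg
    have hω := hG.omegaIntegrand_comp hφ hΦ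
    have hωH := hG.omegaHermIntegrand_comp hφ hΦ
    -- Gradients of the composed functions need not be in L₂ here; integrability comes from
    -- composing an integrable function with a volume preserving map.
    refine ⟨hint, (hmp.integrable_comp_of_integrable hint).congr hω.symm, ?_, hintH,
      (hmp.integrable_comp_of_integrable hintH).congr hωH.symm, ?_⟩
    · exact (integral_congr_ae hω).trans (hmp.integral_comp G.measurableEmbedding _)
    · exact (integral_congr_ae hωH).trans (hmp.integral_comp G.measurableEmbedding _)
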